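/- **Proposition 4.2.** Let $M$ be a paracompact Hausdorff space (for instance, a manifold), let $n\ge 0$, and let $E_0\to M$ and $E_1\to M$ be topological $S^{n-1}$-bundles, that is, locally trivial bundles with fiber the unit sphere $S^{n-1}\subset\mathbb{R}^n$ and structure group $\mathrm{Homeo}(S^{n-1})$. Suppose that they are *fiberwise bordant*: there is an $S^{n-1}\times[0,1]$-bundle $E\to M$, with local trivializations whose transition maps preserve each of $S^{n-1}\times\{0\}$ and $S^{n-1}\times\{1\}$, such that for $i=0,1$ the subbundle of $E$ formed by the parts $S^{n-1}\times\{i\}$ of the fibers is isomorphic over $M$ to $E_i\to M$. For $f\in\mathrm{Homeo}(S^{n-1})$ let $\alpha(f)\in\mathrm{Homeo}(\mathbb{R}^n)$ be given by the Alexander trick: $\alpha(f)(0)=0$ and $\alpha(f)(v)=\|v\|\,f(v/\|v\|)$ for $v\neq0$. For $i=0,1$ let $\widehat E_i\to M$ be the $\mathbb{R}^n$-bundle induced from $E_i\to M$ by $\alpha$, that is, the bundle whose transition functions are the images under $\alpha$ of those of $E_i$. Then $\widehat E_0$ and $\widehat E_1$ are stably isomorphic: for some $k\ge0$ there is a homeomorphism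 $\widehat E_0\times\mathbb{R}^k\to\widehat E_1\times\mathbb{R}^k$ that covers the identity of $M$. -/

import Mathlib

open Set Filter Topology Bundle

noncomputable section

/-- `p : E → M` is a topological fiber bundle with fiber `F` (an `F`-bundle): every point of `M`
lies in the base set of a local trivialization. The structure group is all of `Homeo(F)`. -/
def IsTopBundle (F : Type*) [TopologicalSpace F] {M E : Type*} [TopologicalSpace M]
    [TopologicalSpace E] (p : E → M) : Prop :=
  ∀ b : M, ∃ e : Trivialization F p, b ∈ e.baseSet

/-- Two spaces over `M` are isomorphic: there is a homeomorphism of the total spaces that covers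
the identity of `M`. -/
def BundleIso {M E E' : Type*} [TopologicalSpace E] [TopologicalSpace E']
    (p : E → M) (p' : E' → M) : Prop :=
  ∃ h : E ≃ₜ E', ∀ x, p' (h x) = p x

/-- `q : W → M` is a fiberwise bordism between `p₀ : E₀ → M` and `p₁ : E₁ → M`: it is an
`F × [0,1]`-bundle whose local trivializations match up the parts `F × {0}`, and the parts
`F × {1}`, of the fibers (so that these form subspaces `∂₀`, `∂₁` of `W`), and the restriction of
`q` to `∂₀` (to `∂₁`) is a bundle isomorphic to `p₀` (to `p₁`). -/
def IsFiberwiseBordism (F : Type*) [TopologicalSpace F] {M E₀ E₁ W : Type*} [TopologicalSpace M]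
    [TopologicalSpace E₀] [TopologicalSpace E₁] [TopologicalSpace W]
    (p₀ : E₀ → M) (p₁ : E₁ → M) (q : W → M) : Prop :=
  ∃ bd₀ bd₁ : Set W,
    (∀ b : M, ∃ e : Trivialization (F × unitInterval) q, b ∈ e.baseSet ∧
      ∀ w ∈ e.source, (w ∈ bd₀ ↔ (e w).2.2 = 0) ∧ (w ∈ bd₁ ↔ (e w).2.2 = 1)) ∧
    BundleIso (fun w : bd₀ => q w) p₀ ∧ BundleIso (fun w : bd₁ => q w) p₁

/-- `p₀` and `p₁` are fiberwise bordant `F`-bundles. -/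
def FiberwiseBordant.{w} (F : Type*) [TopologicalSpace F] {M E₀ E₁ : Type*} [TopologicalSpace M]
    [TopologicalSpace E₀] [TopologicalSpace E₁] (p₀ : E₀ → M) (p₁ : E₁ → M) : Prop :=
  ∃ (W : Type w) (_ : TopologicalSpace W) (q : W → M), IsFiberwiseBordism F p₀ p₁ q

/-- Two bundles over `M` become isomorphic after adding a trivial bundle `M × ℝᵏ` for some
`k ≥ 0`; the fiberwise product of `p : X → M` with the trivial bundle is `X × ℝᵏ → X → M`. -/
def StablyIsomorphic {M X X' : Type*} [TopologicalSpace X] [TopologicalSpace X']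
    (p : X → M) (p' : X' → M) : Prop :=
  ∃ k : ℕ, BundleIso (fun z : X × EuclideanSpace ℝ (Fin k) => p z.1)
    (fun z : X' × EuclideanSpace ℝ (Fin k) => p' z.1)

/-- The unit sphere `Sⁿ⁻¹` of `ℝⁿ`. -/
abbrev UnitSphere (n : ℕ) : Type := Metric.sphere (0 : EuclideanSpace ℝ (Fin n)) 1

/-- The radial projection `v ↦ v / ‖v‖` from `ℝⁿ ∖ {0}` to the unit sphere. -/
def radial {n : ℕ} (v : EuclideanSpace ℝ (Fin n)) (hv : v ≠ 0) : UnitSphere n :=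
  ⟨‖v‖⁻¹ • v, by
    have : ‖v‖ ≠ 0 := norm_ne_zero_iff.2 hv
    simp [norm_smul, this]⟩

/-- The Alexander trick: `alexander f` fixes the origin and performs `f` on the sphere of radius
`r` for every `r > 0`. -/
def alexander {n : ℕ} (f : UnitSphere n → UnitSphere n) (v : EuclideanSpace ℝ (Fin n)) :
    EuclideanSpace ℝ (Fin n) :=
  open scoped Classical in
  if hv : v = 0 then 0 else ‖v‖ • (f (radial v hv) : EuclideanSpace ℝ (Fin n))

theorem norm_alexander {n : ℕ} (f : UnitSphere n → UnitSphere n)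
    (v : EuclideanSpace ℝ (Fin n)) : ‖alexander f v‖ = ‖v‖ := by
  unfold alexander
  split_ifs with hv
  · simp [hv]
  · simp [norm_smul]

theorem alexander_id {n : ℕ} {f : UnitSphere n → UnitSphere n} (hf : ∀ x, f x = x)
    (v : EuclideanSpace ℝ (Fin n)) : alexander f v = v := by
  unfold alexander
  split_ifs with hv
  · simp [hv]
  · have : ‖v‖ ≠ 0 := norm_ne_zero_iff.2 hv
    simp [hf, radial, smul_smul, this]

theorem alexander_comp {n : ℕ} {f g h : UnitSphere n → UnitSphere n} (hf : ∀ x, g (f x) = h x)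
    (v : EuclideanSpace ℝ (Fin n)) : alexander g (alexander f v) = alexander h v := by
  by_cases hv : v = 0
  · simp [alexander, hv]
  · have h0 : ‖v‖ ≠ 0 := norm_ne_zero_iff.2 hv
    have h1 : alexander f v ≠ 0 := by
      rw [← norm_ne_zero_iff, norm_alexander]; exact h0
    have h2 : radial (alexander f v) h1 = f (radial v hv) := by
      apply Subtype.ext
      change ‖alexander f v‖⁻¹ • alexander f v = _
      rw [norm_alexander]
      simp [alexander, hv, smul_smul, h0]
    rw [alexander, dif_neg h1, h2, norm_alexander, hf]
    simp [alexander, hv]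

theorem continuousOn_alexander {n : ℕ} {M : Type*} [TopologicalSpace M] {s : Set M}
    {f : M → UnitSphere n → UnitSphere n}
    (hf : ContinuousOn (fun x : M × UnitSphere n => f x.1 x.2) (s ×ˢ univ)) :
    ContinuousOn (fun x : M × EuclideanSpace ℝ (Fin n) => alexander (f x.1) x.2)
      (s ×ˢ univ) := by
  rintro ⟨b, v⟩ hb
  by_cases hv : v = 0
  · subst hv
    have h0 : alexander (f b) (0 : EuclideanSpace ℝ (Fin n)) = 0 := by simp [alexander]
    change Tendsto _ _ (𝓝 (alexander (f b) 0))
    rw [h0]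
    apply squeeze_zero_norm (a := fun x : M × EuclideanSpace ℝ (Fin n) => ‖x.2‖)
    · intro x
      exact (norm_alexander _ _).le
    · have : ContinuousAt (fun x : M × EuclideanSpace ℝ (Fin n) => ‖x.2‖) (b, 0) := by fun_prop
      have h := this.tendsto
      simp only [norm_zero] at h
      exact h.mono_left nhdsWithin_le_nhds
  · have hopen : IsOpen {x : M × EuclideanSpace ℝ (Fin n) | x.2 ≠ 0} :=
      isOpen_ne_fun continuous_snd continuous_const
    rw [← continuousWithinAt_inter (hopen.mem_nhds (x := (b, v)) hv)]
    suffices h : ContinuousOn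
        (fun x : M × EuclideanSpace ℝ (Fin n) => alexander (f x.1) x.2)
        (s ×ˢ univ ∩ {x : M × EuclideanSpace ℝ (Fin n) | x.2 ≠ 0}) from h _ ⟨hb, hv⟩
    rw [continuousOn_iff_continuous_domRestrict]
    have key : Continuous (fun x :
        ↥(s ×ˢ univ ∩ {x : M × EuclideanSpace ℝ (Fin n) | x.2 ≠ 0}) =>
        ‖x.1.2‖ • (f x.1.1 (radial x.1.2 x.2.2) : EuclideanSpace ℝ (Fin n))) := by
      refine Continuous.smul (continuous_norm.comp
        (continuous_snd.comp continuous_subtype_val)) (continuous_subtype_val.comp ?_)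
      refine hf.comp_continuous (f := fun x :
        ↥(s ×ˢ univ ∩ {x : M × EuclideanSpace ℝ (Fin n) | x.2 ≠ 0}) =>
        (x.1.1, radial x.1.2 x.2.2)) ?_ (fun x => ⟨x.2.1.1, mem_univ _⟩)
      have hsnd : Continuous (fun x :
          ↥(s ×ˢ univ ∩ {x : M × EuclideanSpace ℝ (Fin n) | x.2 ≠ 0}) => x.1.2) :=
        continuous_snd.comp continuous_subtype_val
      refine Continuous.prodMk (continuous_fst.comp continuous_subtype_val)
        (Continuous.subtype_mk ?_ _)
      refine Continuous.smul (Continuous.inv₀ hsnd.norm ?_) hsnd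
      exact fun x => norm_ne_zero_iff.2 x.2.2
    refine key.congr fun x => ?_
    simp only [domRestrict_apply, alexander]
    rw [dif_neg x.2.2]

/-- The `ℝⁿ`-bundle induced from an `Sⁿ⁻¹`-bundle `p : E → M` by the Alexander trick: it is glued
from the sets `U × ℝⁿ`, one for each local trivialization of `p` over an open set `U`, along the
images under the Alexander trick of the coordinate changes of `p`. -/
def inducedCore {n : ℕ} {M E : Type*} [TopologicalSpace M] [TopologicalSpace E] {p : E → M}
    (hp : IsTopBundle (UnitSphere n) p) :
    FiberBundleCore (Trivialization (UnitSphere n) p) M (EuclideanSpace ℝ (Fin n)) where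
  baseSet e := e.baseSet
  isOpen_baseSet e := e.open_baseSet
  indexAt b := (hp b).choose
  mem_baseSet_at b := (hp b).choose_spec
  coordChange e e' b := alexander (e.coordChange e' b)
  coordChange_self e b hb := alexander_id (e.coordChange_same_apply hb)
  continuousOn_coordChange e e' := by
    apply continuousOn_alexander
    refine continuous_snd.comp_continuousOn
      (e'.continuousOn_toFun.comp (e.continuousOn_invFun.mono ?_) ?_)
    · rintro ⟨b, x⟩ hb
      exact e.mem_target.2 hb.1.1
    · rintro ⟨b, x⟩ hb
      have := e.proj_symm_apply' (x := x) hb.1.1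
      apply e'.mem_source.2
      exact (congrArg (· ∈ e'.baseSet) this).mpr hb.1.2
  coordChange_comp e e' e'' b hb :=
    alexander_comp (e.coordChange_coordChange e' e'' hb.1.1 hb.1.2)

/-- The projection to `M` of the `ℝⁿ`-bundle induced from `p` by the Alexander trick. -/
abbrev inducedProj {n : ℕ} {M E : Type*} [TopologicalSpace M] [TopologicalSpace E] {p : E → M}
    (hp : IsTopBundle (UnitSphere n) p) : (inducedCore hp).TotalSpace → M :=
  (inducedCore hp).proj

end

/-! Extend the coordinate changes of the bordism conically, by `suspend`, to `ℝⁿ × ℝ`. Because both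
ends are preserved, this is functorial (`suspend_comp`), so the extensions glue to an `ℝⁿ ×
ℝ`-bundle `Z`. On `s < 0` and on `‖v‖ < s` they are Alexander extensions of the two end maps, times
the identity in `s`. Hence `Z` contains open subbundles isomorphic to the products of the two
induced bundles with a line. It remains to see that each of these is isomorphic to all of `Z`; then
`k = 1` suffices.

This is `bundleIso_of_lowerHalf`. Let `O` be an open half of the fibers of `C`. In `C × ℝ`, the set
`growing O` has slice `O` for `t ≤ 0` and slice `C` for `t > 0`. In a chart, an explicit planar flow
moves these slices into each other, translating `t` by any prescribed amount. Charts need not agree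
about the flow, only about `O`. Composing the chart flows, with the functions of a partition of
unity as times, gives a fiberwise homeomorphism that translates `t` by `1`; it carries the slice `O`
at `0` to the slice `C` at `1`. -/

noncomputable section

/-! ### Locally finite compositions of fiberwise homeomorphisms -/

theorem List.prod_map_homeomorph_mem_fiber {ι Z M : Type*} [TopologicalSpace Z] {q : Z → M}
    {T : ι → Z ≃ₜ Z} (hT : ∀ i z, q (T i z) = q z) (L : List ι) (z : Z) :
    q ((L.map T).prod z) = q z := by
  induction L with
  | nil => rfl
  | cons i L ih => rw [List.map_cons, List.prod_cons, Homeomorph.mul_apply, hT, ih]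

theorem List.prod_map_homeomorph_filter {ι Z M : Type*} [TopologicalSpace Z] {q : Z → M}
    {T : ι → Z ≃ₜ Z} (hT : ∀ i z, q (T i z) = q z) {s : ι → Set M}
    (hid : ∀ i z, q z ∉ s i → T i z = z) (b : M) [DecidablePred fun i => b ∈ s i]
    (L : List ι) (z : Z) (hz : q z = b) :
    ((L.filter fun i => b ∈ s i).map T).prod z = (L.map T).prod z := by
  induction L with
  | nil => rfl
  | cons i L ih =>
    rw [List.map_cons, List.prod_cons, Homeomorph.mul_apply, ← ih]
    by_cases hi : b ∈ s i
    · simp [hi]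
    · rw [hid i _ (by rwa [List.prod_map_homeomorph_mem_fiber hT, hz])]
      simp [hi]

/-- The ordered composition of a locally finite family of fiberwise homeomorphisms. -/
theorem exists_homeomorph_of_locallyFinite {ι Z M : Type*} [LinearOrder ι] [TopologicalSpace Z]
    [TopologicalSpace M] {q : Z → M} (hq : Continuous q) {T : ι → Z ≃ₜ Z}
    (hT : ∀ i z, q (T i z) = q z) {s : ι → Set M} (hs : LocallyFinite s)
    (hid : ∀ i z, q z ∉ s i → T i z = z) :
    ∃ H : Z ≃ₜ Z, ∀ z, ∃ L : List ι, L.Nodup ∧ (∀ i, i ∈ L ↔ q z ∈ s i) ∧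
      H z = (L.map T).prod z := by
  classical
  let L : M → List ι := fun b => (hs.point_finite b).toFinset.sort (· ≤ ·)
  have hL : ∀ b i, i ∈ L b ↔ b ∈ s i := fun b i => by simp [L]
  have hloc : ∀ b₀ : M, ∃ U ∈ 𝓝 b₀, ∃ K : List ι, ∀ z, q z ∈ U →
      ((L (q z)).map T).prod z = (K.map T).prod z := by
    intro b₀
    obtain ⟨U, hU, hfin⟩ := hs b₀
    refine ⟨U, hU, hfin.toFinset.sort (· ≤ ·), fun z hz => ?_⟩
    -- The list over `U` contains every index active somewhere in `U`. Those inactive at `q z` act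
    -- trivially on that fiber, and dropping them leaves the sorted list `L (q z)`.
    refine Eq.trans ?_ (List.prod_map_homeomorph_filter hT hid (q z) _ z rfl)
    congr 3
    refine List.Perm.eq_of_pairwise (le := (· ≤ ·)) (fun a b _ _ => le_antisymm)
      (Finset.pairwise_sort _ _) ((Finset.pairwise_sort _ _).filter _) ?_
    refine (List.perm_ext_iff_of_nodup (Finset.sort_nodup _ _)
      ((Finset.sort_nodup _ _).filter _)).2 fun i => ?_
    simp only [List.mem_filter, Finset.mem_sort, Finite.mem_toFinset, mem_ofPred_eq,
      decide_eq_true_eq]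
    exact ⟨fun h => ⟨⟨_, h, hz⟩, h⟩, fun h => h.2⟩
  have hfib := fun b => List.prod_map_homeomorph_mem_fiber hT (L b)
  have hfib' : ∀ (K : List ι) z, q ((K.map T).prod⁻¹ z) = q z := fun K z => by
    rw [← List.prod_map_homeomorph_mem_fiber hT K, ← Homeomorph.mul_apply, mul_inv_cancel]; rfl
  refine ⟨⟨⟨fun z => ((L (q z)).map T).prod z, fun z => ((L (q z)).map T).prod⁻¹ z, ?_, ?_⟩,
    ?_, ?_⟩, fun z => ⟨L (q z), Finset.sort_nodup _ _, hL _, rfl⟩⟩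
  · intro z
    simp only [hfib]
    rw [← Homeomorph.mul_apply, inv_mul_cancel]; rfl
  · intro z
    simp only [hfib']
    rw [← Homeomorph.mul_apply, mul_inv_cancel]; rfl
  · refine continuous_iff_continuousAt.2 fun z => ?_
    obtain ⟨U, hU, K, hK⟩ := hloc (q z)
    refine ((K.map T).prod.continuous.continuousAt).congr ?_
    filter_upwards [hq.continuousAt hU] with w hw
    exact (hK w hw).symm
  · refine continuous_iff_continuousAt.2 fun z => ?_
    obtain ⟨U, hU, K, hK⟩ := hloc (q z)
    refine ((K.map T).prod⁻¹.continuous.continuousAt).congr ?_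
    filter_upwards [hq.continuousAt hU] with w hw
    -- The inverse of the fixed product stays in the fiber of `w`, so `hK` applies at its value and
    -- local equality passes to the inverses.
    apply ((L (q w)).map T).prod.injective
    have h := hK ((K.map T).prod⁻¹ w) (by rw [hfib']; exact hw)
    rw [hfib'] at h
    change _ = ((L (q w)).map T).prod (((L (q w)).map T).prod⁻¹ w)
    rw [h, ← Homeomorph.mul_apply, ← Homeomorph.mul_apply, mul_inv_cancel, mul_inv_cancel]

/-! ### The planar flow -/

/-- The positive root `y` of `y² + u y = max t 0`, for `u < 0` or `0 < t`. -/
def posRoot (u t : ℝ) : ℝ := (√(u ^ 2 + 4 * max t 0) - u) / 2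

theorem posRoot_pos {u t : ℝ} (h : u < 0 ∨ 0 < t) : 0 < posRoot u t := by
  have ht : 0 ≤ max t 0 := le_max_right _ _
  have : u < √(u ^ 2 + 4 * max t 0) := by
    rcases h with h | h
    · exact h.trans_le (Real.sqrt_nonneg _)
    · refine Real.lt_sqrt_of_sq_lt ?_
      have : 0 < max t 0 := lt_max_of_lt_left h
      linarith
  unfold posRoot
  linarith

/-- For fixed `t`, the decreasing function `y ↦ max t 0 / y - y` maps `(0, ∞)` onto `(-∞, 0)` if `t
≤ 0` and onto `ℝ` if `t > 0`. So `(y, t)` are product coordinates on the region, and the flow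
translates `t` with `y` fixed. -/
theorem div_posRoot_sub {u t : ℝ} (h : u < 0 ∨ 0 < t) :
    max t 0 / posRoot u t - posRoot u t = u := by
  have hy := posRoot_pos h
  have ht : 0 ≤ max t 0 := le_max_right _ _
  have hs := Real.sq_sqrt (show 0 ≤ u ^ 2 + 4 * max t 0 by positivity)
  rw [sub_eq_iff_eq_add, div_eq_iff hy.ne']
  unfold posRoot
  nlinarith

theorem posRoot_div_sub {y t : ℝ} (hy : 0 < y) : posRoot (max t 0 / y - y) t = y := by
  have ht : 0 ≤ max t 0 := le_max_right _ _
  have : (max t 0 / y - y) ^ 2 + 4 * max t 0 = (max t 0 / y + y) ^ 2 := by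
    field_simp
    ring
  unfold posRoot
  rw [this, Real.sqrt_sq (by positivity)]
  ring

theorem continuous_posRoot : Continuous fun x : ℝ × ℝ => posRoot x.1 x.2 := by
  unfold posRoot
  fun_prop

/-- A flow over the translations of the `t`-axis, on the region `u < 0 ∨ 0 < t` of the plane. -/
def regionFlow (l u t : ℝ) : ℝ := max (t + l) 0 / posRoot u t - posRoot u t

theorem regionFlow_zero {u t : ℝ} (h : u < 0 ∨ 0 < t) : regionFlow 0 u t = u := by
  rw [regionFlow, add_zero, div_posRoot_sub h]

theorem regionFlow_neg {l u t : ℝ} (h : u < 0 ∨ 0 < t) :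
    regionFlow (-l) (regionFlow l u t) (t + l) = u := by
  rw [regionFlow, regionFlow, posRoot_div_sub (posRoot_pos h), add_neg_cancel_right,
    div_posRoot_sub h]

theorem regionFlow_mem {l u t : ℝ} (h : u < 0 ∨ 0 < t) : regionFlow l u t < 0 ∨ 0 < t + l := by
  rcases lt_or_ge 0 (t + l) with h' | h'
  · exact Or.inr h'
  · left
    rw [regionFlow, max_eq_right h', zero_div, zero_sub]
    exact neg_neg_of_pos (posRoot_pos h)

theorem continuousAt_regionFlow {l u t : ℝ} (h : u < 0 ∨ 0 < t) :
    ContinuousAt (fun x : ℝ × ℝ × ℝ => regionFlow x.1 x.2.1 x.2.2) (l, u, t) := by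
  have hc : ContinuousAt (fun x : ℝ × ℝ × ℝ => posRoot x.2.1 x.2.2) (l, u, t) :=
    (continuous_posRoot.comp continuous_snd).continuousAt
  unfold regionFlow
  refine ContinuousAt.sub (ContinuousAt.div ?_ hc (posRoot_pos h).ne') hc
  fun_prop

/-! ### The flow in a bundle chart -/

/-- In `C × ℝ`, the family over `t ∈ ℝ` that is `O` for `t ≤ 0` and all of `C` for `t > 0`. -/
def growing {C : Type*} (O : Set C) : Set (C × ℝ) := {x | x.1 ∈ O ∨ 0 < x.2}

section ChartFlow

variable {B M C : Type*} [TopologicalSpace B] [TopologicalSpace M] [TopologicalSpace C]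
  {p : C → M} {O : Set C}

open scoped Classical in
/-- The flow of `growing O` in a chart `e` in which `O` is the lower half, for the time `l`. -/
def chartFlow (e : Trivialization (B × ℝ) p) (l : M → ℝ) (x : C × ℝ) : C × ℝ :=
  (if p x.1 ∈ e.baseSet then e.toOpenPartialHomeomorph.symm
      (p x.1, (e x.1).2.1, regionFlow (l (p x.1)) (e x.1).2.2 x.2) else x.1,
    x.2 + l (p x.1))

theorem chartFlow_of_mem (e : Trivialization (B × ℝ) p) (l : M → ℝ) {x : C × ℝ}
    (hx : p x.1 ∈ e.baseSet) :
    chartFlow e l x = (e.toOpenPartialHomeomorph.symm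
      (p x.1, (e x.1).2.1, regionFlow (l (p x.1)) (e x.1).2.2 x.2), x.2 + l (p x.1)) := by
  rw [chartFlow, if_pos hx]

theorem proj_chartFlow (e : Trivialization (B × ℝ) p) (l : M → ℝ) (x : C × ℝ) :
    p (chartFlow e l x).1 = p x.1 := by
  by_cases hx : p x.1 ∈ e.baseSet
  · rw [chartFlow_of_mem e l hx]
    exact e.proj_symm_apply' hx
  · rw [chartFlow, if_neg hx]

variable {e : Trivialization (B × ℝ) p}

theorem growing_iff_chart
    (hO : ∀ z ∈ e.source, z ∈ O ↔ (e z).2.2 < 0)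
    {x : C × ℝ} (hx : p x.1 ∈ e.baseSet) :
    x ∈ growing O ↔ (e x.1).2.2 < 0 ∨ 0 < x.2 :=
  or_congr (hO _ (e.mem_source.2 hx)) Iff.rfl

theorem chartFlow_of_eq_zero
    (hO : ∀ z ∈ e.source, z ∈ O ↔ (e z).2.2 < 0)
    {l : M → ℝ} {x : C × ℝ} (hx : x ∈ growing O) (hl : l (p x.1) = 0) :
    chartFlow e l x = x := by
  by_cases hb : p x.1 ∈ e.baseSet
  · rw [chartFlow_of_mem e l hb, hl, regionFlow_zero ((growing_iff_chart hO hb).1 hx), add_zero]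
    exact Prod.ext (e.symm_apply_mk_proj (e.mem_source.2 hb)) rfl
  · rw [chartFlow, if_neg hb, hl, add_zero]

theorem chartFlow_mem
    (hO : ∀ z ∈ e.source, z ∈ O ↔ (e z).2.2 < 0)
    {l : M → ℝ} (hl : ∀ b, b ∉ e.baseSet → l b = 0) {x : C × ℝ}
    (hx : x ∈ growing O) : chartFlow e l x ∈ growing O := by
  by_cases hb : p x.1 ∈ e.baseSet
  · have hb' := hb
    rw [← proj_chartFlow e l x] at hb'
    rw [growing_iff_chart hO hb', chartFlow_of_mem e l hb, e.apply_symm_apply' hb]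
    exact regionFlow_mem ((growing_iff_chart hO hb).1 hx)
  · rwa [chartFlow_of_eq_zero hO hx (hl _ hb)]

theorem chartFlow_neg
    (hO : ∀ z ∈ e.source, z ∈ O ↔ (e z).2.2 < 0)
    {l l' : M → ℝ} (hl : ∀ b, b ∉ e.baseSet → l b = 0) (hl' : ∀ b, l' b = -l b)
    {x : C × ℝ} (hx : x ∈ growing O) : chartFlow e l' (chartFlow e l x) = x := by
  by_cases hb : p x.1 ∈ e.baseSet
  · have hb' := hb
    rw [← proj_chartFlow e l x] at hb'
    rw [chartFlow_of_mem e l' hb', proj_chartFlow e l x, hl', chartFlow_of_mem e l hb,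
      e.apply_symm_apply' hb]
    dsimp only
    rw [regionFlow_neg ((growing_iff_chart hO hb).1 hx), add_neg_cancel_right]
    exact Prod.ext (e.symm_apply_mk_proj (e.mem_source.2 hb)) rfl
  · rw [chartFlow_of_eq_zero hO hx (hl _ hb), chartFlow_of_eq_zero hO hx]
    rw [hl', hl _ hb, neg_zero]

/-- Over the base set the chart formula is continuous. At any other point `l` vanishes on a
neighborhood, as its closed support lies in the base set, so the flow is locally the identity. -/
theorem continuousOn_chartFlow
    (hO : ∀ z ∈ e.source, z ∈ O ↔ (e z).2.2 < 0)
    (hp : Continuous p) {l : M → ℝ} (hl : Continuous l)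
    (hsupp : tsupport l ⊆ e.baseSet) : ContinuousOn (chartFlow e l) (growing O) := by
  intro x hx
  by_cases hb : p x.1 ∈ e.baseSet
  · have hsrc : x.1 ∈ e.source := e.mem_source.2 hb
    have he : ContinuousAt (fun y : C × ℝ => e y.1) x :=
      (e.toOpenPartialHomeomorph.continuousAt hsrc).comp continuousAt_fst
    have hpc : Continuous fun y : C × ℝ => p y.1 := hp.comp continuous_fst
    have hf : ContinuousAt
        (fun y : C × ℝ => regionFlow (l (p y.1)) (e y.1).2.2 y.2) x := by
      have h2 : ContinuousAt (fun y : C × ℝ => (l (p y.1), (e y.1).2.2, y.2)) x :=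
        (hl.comp hpc).continuousAt.prodMk ((he.snd.snd).prodMk continuousAt_snd)
      exact ContinuousAt.comp (f := fun y : C × ℝ => (l (p y.1), (e y.1).2.2, y.2))
        (continuousAt_regionFlow ((growing_iff_chart hO hb).1 hx)) h2
    have hin : ContinuousAt (fun y : C × ℝ => (p y.1, (e y.1).2.1,
        regionFlow (l (p y.1)) (e y.1).2.2 y.2)) x :=
      hpc.continuousAt.prodMk (he.snd.fst.prodMk hf)
    have hs := ContinuousAt.comp (x := x) (f := fun y : C × ℝ => (p y.1, (e y.1).2.1,
        regionFlow (l (p y.1)) (e y.1).2.2 y.2))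
      (e.toOpenPartialHomeomorph.symm.continuousAt (e.mem_target.2 hb)) hin
    have ht : ContinuousAt (fun y : C × ℝ => y.2 + l (p y.1)) x :=
      (continuous_snd.add (hl.comp hpc)).continuousAt
    refine ((hs.prodMk ht).congr ?_).continuousWithinAt
    filter_upwards [hpc.continuousAt (e.open_baseSet.mem_nhds hb)] with y hy
    exact (chartFlow_of_mem e l hy).symm
  · have hU : (tsupport l)ᶜ ∈ 𝓝 (p x.1) :=
      (isClosed_tsupport l).isOpen_compl.mem_nhds fun h => hb (hsupp h)
    have hpc : ContinuousAt (fun y : C × ℝ => p y.1) x := (hp.comp continuous_fst).continuousAt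
    refine continuousWithinAt_id.congr_of_eventuallyEq ?_
      (chartFlow_of_eq_zero hO hx (image_eq_zero_of_notMem_tsupport fun h => hb (hsupp h)))
    filter_upwards [nhdsWithin_le_nhds (hpc hU), self_mem_nhdsWithin] with y hy hyO
    exact chartFlow_of_eq_zero hO hyO (image_eq_zero_of_notMem_tsupport hy)

/-- The time depends only on the base point, which the flow preserves. Therefore the inverse is the
flow for `-l`, and times add up under composition, even for different charts. -/
theorem exists_chartFlow_homeomorph
    (hO : ∀ z ∈ e.source, z ∈ O ↔ (e z).2.2 < 0)
    (hp : Continuous p) {l : M → ℝ} (hl : Continuous l)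
    (hsupp : tsupport l ⊆ e.baseSet) : ∃ T : growing O ≃ₜ growing O, ∀ x,
      p (T x).1.1 = p x.1.1 ∧ (T x).1.2 = x.1.2 + l (p x.1.1) ∧
      (l (p x.1.1) = 0 → T x = x) := by
  have hz : ∀ b, b ∉ e.baseSet → l b = 0 := fun b hb =>
    image_eq_zero_of_notMem_tsupport fun h => hb (hsupp h)
  have hz' : ∀ b, b ∉ e.baseSet → (-l) b = 0 := fun b hb => by simp [hz b hb]
  have hsupp' : tsupport (-l) ⊆ e.baseSet := by
    rwa [tsupport, Function.support_neg]
  refine ⟨⟨⟨fun x => ⟨chartFlow e l x, chartFlow_mem hO hz x.2⟩,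
    fun x => ⟨chartFlow e (-l) x, chartFlow_mem hO hz' x.2⟩,
    fun x => Subtype.ext (chartFlow_neg hO hz (fun _ => rfl) x.2),
    fun x => Subtype.ext (chartFlow_neg hO hz' (fun _ => (neg_neg _).symm) x.2)⟩, ?_, ?_⟩,
    fun x => ⟨proj_chartFlow e l x, rfl, fun h => Subtype.ext (chartFlow_of_eq_zero hO x.2 h)⟩⟩
  · exact (continuousOn_chartFlow hO hp hl hsupp).domRestrict.subtype_mk _
  · exact (continuousOn_chartFlow hO hp hl.neg hsupp').domRestrict.subtype_mk _

end ChartFlow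

/-! ### The lower half is isomorphic to the whole bundle -/

/-- If, in charts of a bundle with fiber `B × ℝ`, the subspace `O` is the lower half
`B × (-∞, 0)`, then `O` is isomorphic to the whole bundle. -/
theorem bundleIso_of_lowerHalf {B M C : Type*} [TopologicalSpace B] [TopologicalSpace M]
    [T2Space M] [ParacompactSpace M] [TopologicalSpace C] {p : C → M} {O : Set C}
    (h : ∀ b : M, ∃ e : Trivialization (B × ℝ) p, b ∈ e.baseSet ∧
      ∀ z ∈ e.source, z ∈ O ↔ (e z).2.2 < 0) :
    BundleIso (fun z : O => p z) p := by
  classical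
  choose e he hO using h
  have hp : Continuous p := continuous_iff_continuousAt.2 fun z =>
    (e (p z)).continuousAt_proj ((e (p z)).mem_source.2 (he _))
  obtain ⟨ρ, hρ⟩ := PartitionOfUnity.exists_isSubordinate isClosed_univ
    (fun b => (e b).baseSet) (fun b => (e b).open_baseSet) fun b _ => mem_iUnion.2 ⟨b, he b⟩
  choose T hT using fun b => exists_chartFlow_homeomorph (hO b) hp (ρ b).continuous (hρ b)
  -- The partition of unity is indexed by points of `M`; any linear order there fixes the order of
  -- composition.
  let _ : LinearOrder M := linearOrderOfSTO WellOrderingRel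
  have hq : Continuous fun x : growing O => p x.1.1 :=
    hp.comp (continuous_fst.comp continuous_subtype_val)
  obtain ⟨H, hH⟩ := exists_homeomorph_of_locallyFinite (T := T) hq (fun i x => (hT i x).1)
    ρ.locallyFinite fun i x hx => (hT i x).2.2 (Function.notMem_support.1 hx)
  have hHp : ∀ x, p (H x).1.1 = p x.1.1 := fun x => by
    obtain ⟨L, -, -, hx⟩ := hH x
    rw [hx]
    exact List.prod_map_homeomorph_mem_fiber (q := fun x : growing O => p x.1.1)
      (fun i x => (hT i x).1) L x
  have hHt : ∀ x, (H x).1.2 = x.1.2 + 1 := fun x => by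
    obtain ⟨L, hL, hmem, hx⟩ := hH x
    have hprod : ∀ K : List M, ((K.map T).prod x).1.2 =
        x.1.2 + (K.map fun i => ρ i (p x.1.1)).sum := fun K => by
      induction K with
      | nil => simp
      | cons i K ih =>
        rw [List.map_cons, List.prod_cons, Homeomorph.mul_apply, (hT i _).2.1, ih,
          List.prod_map_homeomorph_mem_fiber (q := fun x : growing O => p x.1.1)
            (fun i x => (hT i x).1) K x, List.map_cons, List.sum_cons]
        ring
    -- The total time is the sum of the partition of unity at the base point, which is `1`.
    rw [hx, hprod, ← List.sum_toFinset _ hL, ← ρ.sum_eq_one (mem_univ (p x.1.1)),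
      finsum_eq_sum_of_support_subset]
    intro i hi
    simpa [hmem] using hi
  have hsymmt : ∀ x, (H.symm x).1.2 = x.1.2 - 1 := fun x => by
    rw [eq_sub_iff_add_eq, ← hHt, H.apply_symm_apply]
  -- The slices at `t = 0` and `t = 1` are `O` and `C`; `H` and its inverse exchange them.
  let f : O → growing O := fun z => ⟨(z, 0), Or.inl z.2⟩
  let g : C → growing O := fun z => ⟨(z, 1), Or.inr one_pos⟩
  have hmem : ∀ z : C, (H.symm (g z)).1.1 ∈ O := fun z =>
    (H.symm (g z)).2.resolve_right (by rw [hsymmt]; simp [g])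
  refine ⟨⟨⟨fun z => (H (f z)).1.1, fun z => ⟨(H.symm (g z)).1.1, hmem z⟩, fun z => ?_,
    fun z => ?_⟩, ?_, ?_⟩, fun z => hHp (f z)⟩
  · have : g (H (f z)).1.1 = H (f z) :=
      Subtype.ext (Prod.ext rfl (by rw [hHt]; simp [f, g]))
    apply Subtype.ext
    change (H.symm (g (H (f z)).1.1)).1.1 = z
    rw [this, H.symm_apply_apply]
  · have : f ⟨(H.symm (g z)).1.1, hmem z⟩ = H.symm (g z) :=
      Subtype.ext (Prod.ext rfl (by rw [hsymmt]; simp [f, g]))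
    change (H (f ⟨(H.symm (g z)).1.1, hmem z⟩)).1.1 = z
    rw [this, H.apply_symm_apply]
  · have : Continuous f := by fun_prop
    exact continuous_fst.comp (continuous_subtype_val.comp (H.continuous.comp this))
  · have : Continuous g := by fun_prop
    exact (continuous_fst.comp (continuous_subtype_val.comp
      (H.symm.continuous.comp this))).subtype_mk _

/-! ### Recognizing the product with a line -/

theorem BundleIso.symm {M E E' : Type*} [TopologicalSpace E] [TopologicalSpace E']
    {p : E → M} {p' : E' → M} (h : BundleIso p p') : BundleIso p' p := by
  obtain ⟨f, hf⟩ := h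
  exact ⟨f.symm, fun x => by rw [← hf, f.apply_symm_apply]⟩

theorem BundleIso.trans {M E E' E'' : Type*} [TopologicalSpace E] [TopologicalSpace E']
    [TopologicalSpace E''] {p : E → M} {p' : E' → M} {p'' : E'' → M}
    (h : BundleIso p p') (h' : BundleIso p' p'') : BundleIso p p'' := by
  obtain ⟨f, hf⟩ := h
  obtain ⟨g, hg⟩ := h'
  exact ⟨f.trans g, fun x => by rw [Homeomorph.trans_apply, hg, hf]⟩

/-- `ℝ¹` is the line. -/
def lineHomeomorph : EuclideanSpace ℝ (Fin 1) ≃ₜ ℝ where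
  toFun x := x 0
  invFun r := WithLp.toLp 2 fun _ => r
  left_inv x := by ext i; rw [Subsingleton.elim i 0]
  right_inv _ := rfl
  continuous_toFun := by fun_prop
  continuous_invFun := by fun_prop

theorem Bundle.Trivialization.symm_coordChange {F M X : Type*} [TopologicalSpace F]
    [TopologicalSpace M] [TopologicalSpace X] {p : X → M} (e e' : Trivialization F p) {b : M}
    (h : b ∈ e.baseSet) (h' : b ∈ e'.baseSet) (v : F) :
    e'.toOpenPartialHomeomorph.symm (b, e.coordChange e' b v) =
      e.toOpenPartialHomeomorph.symm (b, v) := by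
  rw [e.mk_coordChange e' h h']
  refine e'.toOpenPartialHomeomorph.left_inv (e'.mem_source.2 ?_)
  rwa [e.proj_symm_apply' h]

section LowerHalf

variable {ι F M X C : Type*} [TopologicalSpace F] [TopologicalSpace M]
  [TopologicalSpace X] [TopologicalSpace C] {p : X → M} {p' : C → M}

/-- In charts, the embedding `(v, r) ↦ (v, -exp r)`. -/
def toLowerHalf (e : Trivialization F p) (e' : Trivialization (F × ℝ) p') (x : X × ℝ) : C :=
  e'.toOpenPartialHomeomorph.symm (p x.1, (e x.1).2, -Real.exp x.2)

/-- In charts, the inverse of `(v, r) ↦ (v, -exp r)`. -/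
def ofLowerHalf (e : Trivialization F p) (e' : Trivialization (F × ℝ) p') (z : C) : X × ℝ :=
  (e.toOpenPartialHomeomorph.symm (p' z, (e' z).2.1), Real.log (-(e' z).2.2))

theorem proj_toLowerHalf (e : Trivialization F p) (e' : Trivialization (F × ℝ) p') {x : X × ℝ}
    (hx : p x.1 ∈ e'.baseSet) : p' (toLowerHalf e e' x) = p x.1 :=
  e'.proj_symm_apply' hx

theorem apply_toLowerHalf (e : Trivialization F p) (e' : Trivialization (F × ℝ) p') {x : X × ℝ}
    (hx : p x.1 ∈ e'.baseSet) :
    e' (toLowerHalf e e' x) = (p x.1, (e x.1).2, -Real.exp x.2) :=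
  e'.apply_symm_apply' hx

theorem proj_ofLowerHalf (e : Trivialization F p) (e' : Trivialization (F × ℝ) p') {z : C}
    (hz : p' z ∈ e.baseSet) : p (ofLowerHalf e e' z).1 = p' z :=
  e.proj_symm_apply' hz

theorem ofLowerHalf_toLowerHalf (e : Trivialization F p) (e' : Trivialization (F × ℝ) p')
    {x : X × ℝ} (hx : p x.1 ∈ e.baseSet) (hx' : p x.1 ∈ e'.baseSet) :
    ofLowerHalf e e' (toLowerHalf e e' x) = x := by
  rw [ofLowerHalf, apply_toLowerHalf e e' hx', proj_toLowerHalf e e' hx']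
  dsimp only
  rw [neg_neg, Real.log_exp, e.symm_apply_mk_proj (e.mem_source.2 hx)]

theorem toLowerHalf_ofLowerHalf (e : Trivialization F p) (e' : Trivialization (F × ℝ) p')
    {z : C} (hz : p' z ∈ e.baseSet) (hz' : p' z ∈ e'.baseSet) (hneg : (e' z).2.2 < 0) :
    toLowerHalf e e' (ofLowerHalf e e' z) = z := by
  rw [toLowerHalf, proj_ofLowerHalf e e' hz, ofLowerHalf, e.apply_symm_apply' hz]
  dsimp only
  rw [Real.exp_log (neg_pos.2 hneg), neg_neg]
  exact e'.symm_apply_mk_proj (e'.mem_source.2 hz')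

theorem continuousAt_toLowerHalf (e : Trivialization F p) (e' : Trivialization (F × ℝ) p')
    {x : X × ℝ} (hx : p x.1 ∈ e.baseSet) (hx' : p x.1 ∈ e'.baseSet) :
    ContinuousAt (toLowerHalf e e') x := by
  have hsrc := e.mem_source.2 hx
  have he : ContinuousAt (fun y : X × ℝ => e y.1) x :=
    (e.toOpenPartialHomeomorph.continuousAt hsrc).comp continuousAt_fst
  have hp : ContinuousAt (fun y : X × ℝ => p y.1) x :=
    (e.continuousAt_proj hsrc).comp continuousAt_fst
  exact ContinuousAt.comp (f := fun y : X × ℝ => (p y.1, (e y.1).2, -Real.exp y.2))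
    (e'.toOpenPartialHomeomorph.symm.continuousAt (e'.mem_target.2 hx'))
    (hp.prodMk (he.snd.prodMk (by fun_prop)))

theorem continuousAt_ofLowerHalf (e : Trivialization F p) (e' : Trivialization (F × ℝ) p')
    {z : C} (hz : p' z ∈ e.baseSet) (hz' : p' z ∈ e'.baseSet) (hneg : (e' z).2.2 < 0) :
    ContinuousAt (ofLowerHalf e e') z := by
  have hsrc := e'.mem_source.2 hz'
  have he : ContinuousAt e' z := e'.toOpenPartialHomeomorph.continuousAt hsrc
  have hp : ContinuousAt p' z := e'.continuousAt_proj hsrc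
  refine ContinuousAt.prodMk ?_ (ContinuousAt.log he.snd.snd.neg (neg_pos.2 hneg).ne')
  exact ContinuousAt.comp (f := fun y => (p' y, (e' y).2.1))
    (e.toOpenPartialHomeomorph.symm.continuousAt (e.mem_target.2 hz)) (hp.prodMk he.snd.fst)

/-- If, where `s < 0`, the coordinate changes `(v, s) ↦ (g v, s)` of a bundle with fiber `F × ℝ`
come from those of a bundle `p` with fiber `F`, then it is isomorphic to the product of `p` with
a line. -/
theorem bundleIso_prod_line_of_coordChange [T2Space M] [ParacompactSpace M]
    (e : ι → Trivialization F p) (e' : ι → Trivialization (F × ℝ) p')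
    (hbase : ∀ i, (e' i).baseSet = (e i).baseSet) (hcover : ∀ b, ∃ i, b ∈ (e i).baseSet)
    (hcc : ∀ i j b, b ∈ (e i).baseSet → b ∈ (e j).baseSet → ∀ v s, s < 0 →
      (e' i).coordChange (e' j) b (v, s) = ((e i).coordChange (e j) b v, s)) :
    BundleIso (fun z : X × EuclideanSpace ℝ (Fin 1) => p z.1) p' := by
  choose k hk using hcover
  have hk' : ∀ b, b ∈ (e' (k b)).baseSet := fun b => (hbase _).symm ▸ hk b
  have hsnd : ∀ i j z, p' z ∈ (e i).baseSet → p' z ∈ (e j).baseSet → (e' i z).2.2 < 0 →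
      (e' j z).2 = ((e i).coordChange (e j) (p' z) (e' i z).2.1, (e' i z).2.2) := by
    intro i j z hi hj hneg
    rw [← hcc i j _ hi hj _ _ hneg]
    exact ((e' i).coordChange_apply_snd (e' j) ((hbase i).symm ▸ hi)).symm
  have hto : ∀ i j x, p x.1 ∈ (e i).baseSet → p x.1 ∈ (e j).baseSet →
      toLowerHalf (e i) (e' i) x = toLowerHalf (e j) (e' j) x := by
    intro i j x hi hj
    rw [toLowerHalf, toLowerHalf, ← (e i).coordChange_apply_snd (e j) hi,
      ← hcc i j _ hi hj _ _ (neg_neg_of_pos (Real.exp_pos _)),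
      (e' i).symm_coordChange (e' j) ((hbase i).symm ▸ hi) ((hbase j).symm ▸ hj)]
  have hof : ∀ i j z, p' z ∈ (e i).baseSet → p' z ∈ (e j).baseSet → (e' i z).2.2 < 0 →
      ofLowerHalf (e i) (e' i) z = ofLowerHalf (e j) (e' j) z := by
    intro i j z hi hj hneg
    rw [ofLowerHalf, ofLowerHalf, hsnd i j z hi hj hneg, (e i).symm_coordChange (e j) hi hj]
  -- By `hsnd`, a negative line coordinate is the same in all charts, so the choice of chart does
  -- not affect `O`.
  let O : Set C := {z | (e' (k (p' z)) z).2.2 < 0}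
  have hO : ∀ i, ∀ z ∈ (e' i).source, z ∈ O ↔ (e' i z).2.2 < 0 := by
    intro i z hz
    have hi : p' z ∈ (e i).baseSet := hbase i ▸ (e' i).mem_source.1 hz
    constructor
    · intro h
      rw [hsnd _ i z (hk _) hi h]
      exact h
    · intro h
      change (e' (k (p' z)) z).2.2 < 0
      rw [hsnd i _ z hi (hk _) h]
      exact h
  refine BundleIso.trans ?_ (bundleIso_of_lowerHalf (p := p') (O := O)
    fun b => ⟨e' (k b), hk' b, hO (k b)⟩)
  have hmem : ∀ x : X × ℝ, toLowerHalf (e (k (p x.1))) (e' (k (p x.1))) x ∈ O := by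
    intro x
    have h : p' (toLowerHalf (e (k (p x.1))) (e' (k (p x.1))) x) ∈ (e' (k (p x.1))).baseSet := by
      rw [proj_toLowerHalf _ _ (hk' _)]
      exact hk' _
    rw [hO _ _ ((e' _).mem_source.2 h), apply_toLowerHalf _ _ (hk' _)]
    exact neg_neg_of_pos (Real.exp_pos _)
  have hproj := fun x : X × ℝ => proj_toLowerHalf (e (k (p x.1))) _ (hk' (p x.1))
  let f : X × ℝ ≃ₜ O :=
    { toFun := fun x => ⟨toLowerHalf (e (k (p x.1))) (e' (k (p x.1))) x, hmem x⟩
      invFun := fun z => ofLowerHalf (e (k (p' z))) (e' (k (p' z))) z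
      left_inv := fun x => by
        dsimp only
        rw [hproj]
        exact ofLowerHalf_toLowerHalf _ _ (hk _) (hk' _)
      right_inv := fun z => by
        apply Subtype.ext
        dsimp only
        rw [proj_ofLowerHalf _ _ (hk _)]
        exact toLowerHalf_ofLowerHalf _ _ (hk _) (hk' _) z.2
      continuous_toFun := by
        refine Continuous.subtype_mk (continuous_iff_continuousAt.2 fun x => ?_) _
        refine (continuousAt_toLowerHalf _ _ (hk (p x.1)) (hk' (p x.1))).congr ?_
        have hp : ContinuousAt (fun y : X × ℝ => p y.1) x :=
          ((e _).continuousAt_proj ((e _).mem_source.2 (hk (p x.1)))).comp continuousAt_fst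
        filter_upwards [hp ((e (k (p x.1))).open_baseSet.mem_nhds (hk _))] with y hy
        exact hto _ _ y hy (hk _)
      continuous_invFun := by
        refine continuous_iff_continuousAt.2 fun z => ?_
        have hp : ContinuousAt (fun y : O => p' y) z :=
          ((e' _).continuousAt_proj ((e' _).mem_source.2 (hk' (p' z)))).comp
            continuousAt_subtype_val
        refine ContinuousAt.congr (ContinuousAt.comp (f := Subtype.val)
          (continuousAt_ofLowerHalf _ _ (hk (p' z)) (hk' (p' z)) z.2)
          continuousAt_subtype_val) ?_
        filter_upwards [hp ((e (k (p' z))).open_baseSet.mem_nhds (hk _))] with y hy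
        refine hof _ _ _ hy (hk _) ((hO _ _ ((e' _).mem_source.2 ?_)).1 y.2)
        rw [hbase]
        exact hy }
  exact ⟨((Homeomorph.refl X).prodCongr lineHomeomorph).trans f, fun x => hproj _⟩

end LowerHalf

/-! ### Conical extension -/

section Suspend

variable {n : ℕ}

/-- The unit interval coordinate of the point of `[0, r]` nearest to `s`. -/
def clampRatio (s r : ℝ) : unitInterval := projIcc 0 1 zero_le_one (s / r)

/-- The conical extension to `ℝⁿ × ℝ` of a map of `Sⁿ⁻¹ × [0,1]` that preserves both ends: it
maps the points `(r θ, r u)` with `(θ, u) ∈ Sⁿ⁻¹ × [0,1]` to `(r θ', r u')`, where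
`(θ', u') = f (θ, u)`, and preserves the second coordinate of all other points. -/
def suspend (f : UnitSphere n × unitInterval → UnitSphere n × unitInterval)
    (x : EuclideanSpace ℝ (Fin n) × ℝ) : EuclideanSpace ℝ (Fin n) × ℝ :=
  open scoped Classical in
  if hv : x.1 = 0 then x else
    (‖x.1‖ • ((f (radial x.1 hv, clampRatio x.2 ‖x.1‖)).1 : EuclideanSpace ℝ (Fin n)),
      x.2 + ‖x.1‖ * ((f (radial x.1 hv, clampRatio x.2 ‖x.1‖)).2 - clampRatio x.2 ‖x.1‖))

variable {f g h : UnitSphere n × unitInterval → UnitSphere n × unitInterval}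

theorem suspend_of_ne (f : UnitSphere n × unitInterval → UnitSphere n × unitInterval)
    {v : EuclideanSpace ℝ (Fin n)} (hv : v ≠ 0) (s : ℝ) : suspend f (v, s) =
    (‖v‖ • ((f (radial v hv, clampRatio s ‖v‖)).1 : EuclideanSpace ℝ (Fin n)),
      s + ‖v‖ * ((f (radial v hv, clampRatio s ‖v‖)).2 - clampRatio s ‖v‖)) :=
  dif_neg hv

theorem suspend_zero (f : UnitSphere n × unitInterval → UnitSphere n × unitInterval) (s : ℝ) :
    suspend f (0, s) = (0, s) :=
  dif_pos rfl

theorem radial_smul {r : ℝ} (hr : 0 < r) (θ : UnitSphere n)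
    (h : r • (θ : EuclideanSpace ℝ (Fin n)) ≠ 0) :
    radial (r • (θ : EuclideanSpace ℝ (Fin n))) h = θ := by
  apply Subtype.ext
  simp [radial, norm_smul, smul_smul, hr.ne', abs_of_pos hr]

theorem norm_fst_suspend (f : UnitSphere n × unitInterval → UnitSphere n × unitInterval)
    (x : EuclideanSpace ℝ (Fin n) × ℝ) : ‖(suspend f x).1‖ = ‖x.1‖ := by
  obtain ⟨v, s⟩ := x
  by_cases hv : v = 0
  · rw [hv, suspend_zero]
  · simp [suspend_of_ne f hv, norm_smul]

/-- Together with `norm_fst_suspend`, this bound, uniform in `f`, gives continuity along `v = 0`. -/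
theorem abs_snd_suspend_sub_le (f : UnitSphere n × unitInterval → UnitSphere n × unitInterval)
    (x : EuclideanSpace ℝ (Fin n) × ℝ) : |(suspend f x).2 - x.2| ≤ ‖x.1‖ := by
  obtain ⟨v, s⟩ := x
  by_cases hv : v = 0
  · simp [hv, suspend_zero]
  · rw [suspend_of_ne f hv]
    dsimp only
    rw [add_sub_cancel_left, abs_mul, abs_of_nonneg (norm_nonneg v)]
    refine mul_le_of_le_one_right (norm_nonneg v) (abs_sub_le_iff.2 ⟨?_, ?_⟩)
    · linarith [(f (radial v hv, clampRatio s ‖v‖)).2.2.2, (clampRatio s ‖v‖).2.1]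
    · linarith [(f (radial v hv, clampRatio s ‖v‖)).2.2.1, (clampRatio s ‖v‖).2.2]

theorem suspend_id (hf : ∀ x, f x = x) (x : EuclideanSpace ℝ (Fin n) × ℝ) : suspend f x = x := by
  obtain ⟨v, s⟩ := x
  by_cases hv : v = 0
  · rw [hv, suspend_zero]
  · have : ‖v‖ ≠ 0 := norm_ne_zero_iff.2 hv
    simp [suspend_of_ne f hv, hf, radial, smul_smul, this]

/-- Here the clamped ratio is `0` and `f` preserves that end, so the correction to `s` vanishes. -/
theorem suspend_of_neg (hf : ∀ θ, (f (θ, 0)).2 = 0) (v : EuclideanSpace ℝ (Fin n)) {s : ℝ}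
    (hs : s < 0) : suspend f (v, s) = (alexander (fun θ => (f (θ, 0)).1) v, s) := by
  by_cases hv : v = 0
  · simp [hv, suspend_zero, alexander]
  · have : clampRatio s ‖v‖ = 0 :=
      projIcc_of_le_left _ (div_nonpos_of_nonpos_of_nonneg hs.le (norm_nonneg v))
    simp [suspend_of_ne f hv, alexander, hv, this, hf]

theorem suspend_of_norm_lt (hf : ∀ θ, (f (θ, 1)).2 = 1) (v : EuclideanSpace ℝ (Fin n)) {s : ℝ}
    (hs : ‖v‖ < s) : suspend f (v, s) = (alexander (fun θ => (f (θ, 1)).1) v, s) := by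
  by_cases hv : v = 0
  · simp [hv, suspend_zero, alexander]
  · have : clampRatio s ‖v‖ = 1 :=
      projIcc_of_right_le _ ((one_le_div (norm_pos_iff.2 hv)).2 hs.le)
    simp [suspend_of_ne f hv, alexander, hv, this, hf]

/-- The point is that the clamped ratio of the image is the interval coordinate of `f (θ, c)`.
Inside `[0, 1]` the ratio is not clamped; outside, the ratio does not change because `f` preserves
the ends. -/
theorem suspend_comp (hf₀ : ∀ θ, (f (θ, 0)).2 = 0) (hf₁ : ∀ θ, (f (θ, 1)).2 = 1)
    (hh : ∀ x, g (f x) = h x) (x : EuclideanSpace ℝ (Fin n) × ℝ) :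
    suspend g (suspend f x) = suspend h x := by
  obtain ⟨v, s⟩ := x
  by_cases hv : v = 0
  · simp [hv, suspend_zero]
  · have hr : 0 < ‖v‖ := norm_pos_iff.2 hv
    set θ := radial v hv
    set c := clampRatio s ‖v‖ with hc
    have hsf : suspend f (v, s) = (‖v‖ • ((f (θ, c)).1 : EuclideanSpace ℝ (Fin n)),
        s + ‖v‖ * ((f (θ, c)).2 - c)) := suspend_of_ne f hv s
    have hn : ‖‖v‖ • ((f (θ, c)).1 : EuclideanSpace ℝ (Fin n))‖ = ‖v‖ := by simp [norm_smul]
    have hne : ‖v‖ • ((f (θ, c)).1 : EuclideanSpace ℝ (Fin n)) ≠ 0 := by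
      rw [← norm_ne_zero_iff, hn]
      exact hr.ne'
    have hclamp : clampRatio (s + ‖v‖ * ((f (θ, c)).2 - c)) ‖v‖ = (f (θ, c)).2 := by
      have : (s + ‖v‖ * ((f (θ, c)).2 - c)) / ‖v‖ = s / ‖v‖ + ((f (θ, c)).2 - c) := by
        field_simp
      rw [clampRatio, this]
      rcases le_total (s / ‖v‖) 0 with h0 | h0
      · have hc0 : c = 0 := projIcc_of_le_left _ h0
        rw [hc0, hf₀]
        exact projIcc_of_le_left _ (by simpa using h0)
      rcases le_total 1 (s / ‖v‖) with h1 | h1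
      · have hc1 : c = 1 := projIcc_of_right_le _ h1
        rw [hc1, hf₁]
        exact projIcc_of_right_le _ (by simpa using h1)
      · have hcu : (c : ℝ) = s / ‖v‖ := by
          rw [hc, clampRatio, projIcc_of_mem _ ⟨h0, h1⟩]
        rw [← hcu, add_sub_cancel, projIcc_val]
    rw [hsf, suspend_of_ne g hne, suspend_of_ne h hv, radial_smul hr, hn, hclamp, Prod.mk.eta, hh]
    congr 1
    ring

theorem continuousOn_suspend {M : Type*} [TopologicalSpace M] {s : Set M}
    {f : M → UnitSphere n × unitInterval → UnitSphere n × unitInterval}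
    (hf : ContinuousOn (fun x : M × UnitSphere n × unitInterval => f x.1 x.2) (s ×ˢ univ)) :
    ContinuousOn (fun x : M × EuclideanSpace ℝ (Fin n) × ℝ => suspend (f x.1) x.2)
      (s ×ˢ univ) := by
  rintro ⟨b, v, t⟩ hb
  by_cases hv : v = 0
  · subst hv
    refine ContinuousAt.continuousWithinAt ?_
    change Tendsto _ _ (𝓝 (suspend (f b) (0, t)))
    rw [suspend_zero]
    have hn : Tendsto (fun x : M × EuclideanSpace ℝ (Fin n) × ℝ => ‖x.2.1‖) (𝓝 (b, 0, t))
        (𝓝 0) := by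
      have : ContinuousAt (fun x : M × EuclideanSpace ℝ (Fin n) × ℝ => ‖x.2.1‖) (b, 0, t) := by
        fun_prop
      simpa using this.tendsto
    refine Tendsto.prodMk_nhds ?_ ?_
    · exact squeeze_zero_norm (fun x => (norm_fst_suspend _ _).le) hn
    · have h1 : Tendsto (fun x : M × EuclideanSpace ℝ (Fin n) × ℝ =>
          (suspend (f x.1) x.2).2 - x.2.2) (𝓝 (b, 0, t)) (𝓝 0) :=
        squeeze_zero_norm (fun x => abs_snd_suspend_sub_le _ _) hn
      have h2 : Tendsto (fun x : M × EuclideanSpace ℝ (Fin n) × ℝ => x.2.2) (𝓝 (b, 0, t))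
          (𝓝 t) := (continuous_snd.comp continuous_snd).tendsto _
      have h3 := h1.add h2
      rw [zero_add] at h3
      exact h3.congr fun x => sub_add_cancel _ _
  · have hopen : IsOpen {x : M × EuclideanSpace ℝ (Fin n) × ℝ | x.2.1 ≠ 0} :=
      isOpen_ne_fun (by fun_prop) continuous_const
    rw [← continuousWithinAt_inter (hopen.mem_nhds (x := (b, v, t)) hv)]
    set A := s ×ˢ univ ∩ {x : M × EuclideanSpace ℝ (Fin n) × ℝ | x.2.1 ≠ 0}
    suffices h : ContinuousOn
        (fun x : M × EuclideanSpace ℝ (Fin n) × ℝ => suspend (f x.1) x.2) A from h _ ⟨hb, hv⟩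
    rw [continuousOn_iff_continuous_domRestrict]
    have hnorm : Continuous fun x : A => ‖x.1.2.1‖ := by fun_prop
    have hinv : Continuous fun x : A => ‖x.1.2.1‖⁻¹ :=
      hnorm.inv₀ fun x => norm_ne_zero_iff.2 x.2.2
    have hrad : Continuous fun x : A => radial x.1.2.1 x.2.2 :=
      Continuous.subtype_mk (hinv.smul (by fun_prop)) _
    have hcl : Continuous fun x : A => clampRatio x.1.2.2 ‖x.1.2.1‖ := by
      refine continuous_projIcc.comp ?_
      simp only [div_eq_mul_inv]
      exact Continuous.mul (by fun_prop) hinv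
    have hfc : Continuous fun x : A =>
        f x.1.1 (radial x.1.2.1 x.2.2, clampRatio x.1.2.2 ‖x.1.2.1‖) :=
      hf.comp_continuous (f := fun x : A =>
        (x.1.1, radial x.1.2.1 x.2.2, clampRatio x.1.2.2 ‖x.1.2.1‖))
        (Continuous.prodMk (by fun_prop) (hrad.prodMk hcl)) (fun x => ⟨x.2.1.1, mem_univ _⟩)
    have key := (hnorm.smul (continuous_subtype_val.comp hfc.fst)).prodMk
      (Continuous.add (f := fun x : A => x.1.2.2) (by fun_prop)
        (hnorm.mul ((continuous_subtype_val.comp hfc.snd).sub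
          (continuous_subtype_val.comp hcl))))
    exact key.congr fun x => (suspend_of_ne (f x.1.1) x.2.2 x.1.2.2).symm

end Suspend

/-! ### Charts of the two ends -/

section Boundary

variable {S M W E : Type*} [TopologicalSpace S] [TopologicalSpace M] [TopologicalSpace W]
  [TopologicalSpace E] {q : W → M} {p : E → M} {bd : Set W} {c : unitInterval}

/-- A trivialization of an `S × [0,1]`-bundle in which the subspace `bd` is the slice `S × {c}`
restricts to a trivialization of the bundle `p` isomorphic to `bd`. -/
def boundaryTrivialization (e : Trivialization (S × unitInterval) q)
    (he : ∀ w ∈ e.source, w ∈ bd ↔ (e w).2.2 = c) (φ : bd ≃ₜ E) (hφ : ∀ w, p (φ w) = q w)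
    (junk : M × S → E) : Trivialization S p :=
  have hmem : ∀ y : M × S, y.1 ∈ e.baseSet →
      e.toOpenPartialHomeomorph.symm (y.1, y.2, c) ∈ bd := fun y hy =>
    (he _ (e.map_target (e.mem_target.2 hy))).2 (by rw [e.apply_symm_apply' hy])
  have hq : ∀ x, q (φ.symm x) = p x := fun x => by rw [← hφ, φ.apply_symm_apply]
  have hsrc : ∀ x, p x ∈ e.baseSet → (φ.symm x : W) ∈ e.source := fun x hx =>
    e.mem_source.2 ((hq x).symm ▸ hx)
  open scoped Classical in
  { toFun := fun x => (p x, (e (φ.symm x)).2.1)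
    invFun := fun y => if hy : y.1 ∈ e.baseSet then φ ⟨_, hmem y hy⟩ else junk y
    source := p ⁻¹' e.baseSet
    target := e.baseSet ×ˢ univ
    map_source' := fun x hx => ⟨hx, mem_univ _⟩
    map_target' := fun y hy => by
      rw [dif_pos hy.1, mem_preimage, hφ]
      exact e.map_target (e.mem_target.2 hy.1) |> e.mem_source.1
    left_inv' := fun x hx => by
      have h : (⟨_, hmem (p x, (e (φ.symm x)).2.1) hx⟩ : bd) = φ.symm x := by
        apply Subtype.ext
        dsimp only
        have hc : (e (φ.symm x)).2.2 = c := (he _ (hsrc x hx)).1 (φ.symm x).2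
        rw [← hc, ← hq x]
        exact e.symm_apply_mk_proj (hsrc x hx)
      rw [dif_pos (show (p x, (e (φ.symm x)).2.1).1 ∈ e.baseSet from hx), h,
        φ.apply_symm_apply]
    right_inv' := fun y hy => by
      have h : p (φ ⟨_, hmem y hy.1⟩) = y.1 := by
        rw [hφ]
        exact e.proj_symm_apply' hy.1
      rw [dif_pos hy.1, h, φ.symm_apply_apply, e.apply_symm_apply' hy.1]
    open_source := by
      have : p ⁻¹' e.baseSet = (fun x => (φ.symm x : W)) ⁻¹' e.source := by
        ext x
        rw [mem_preimage, mem_preimage, e.mem_source, hq]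
      rw [this]
      exact e.open_source.preimage (continuous_subtype_val.comp φ.symm.continuous)
    open_target := e.open_baseSet.prod isOpen_univ
    continuousOn_toFun := by
      have hφc : Continuous fun x => (φ.symm x : W) :=
        continuous_subtype_val.comp φ.symm.continuous
      have h : ContinuousOn (fun x => e (φ.symm x)) (p ⁻¹' e.baseSet) :=
        e.toOpenPartialHomeomorph.continuousOn.comp hφc.continuousOn hsrc
      refine ContinuousOn.prodMk (h.fst.congr fun x hx => ?_) h.snd.fst
      exact ((e.coe_fst (hsrc x hx)).trans (hq x)).symm
    continuousOn_invFun := by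
      rw [continuousOn_iff_continuous_domRestrict]
      have h : Continuous fun y : ↥(e.baseSet ×ˢ (univ : Set S)) =>
          e.toOpenPartialHomeomorph.symm (y.1.1, y.1.2, c) :=
        e.toOpenPartialHomeomorph.symm.continuousOn.comp_continuous (by fun_prop)
          fun y => e.mem_target.2 y.2.1
      refine (φ.continuous.comp (h.subtype_mk fun y => hmem y.1 y.2.1)).congr fun y => ?_
      rw [domRestrict_apply, dif_pos y.2.1]
      rfl
    baseSet := e.baseSet
    open_baseSet := e.open_baseSet
    source_eq := rfl
    target_eq := rfl
    proj_toFun := fun _ _ => rfl }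

theorem boundaryTrivialization_coordChange {e e' : Trivialization (S × unitInterval) q}
    (he : ∀ w ∈ e.source, w ∈ bd ↔ (e w).2.2 = c) (he' : ∀ w ∈ e'.source, w ∈ bd ↔ (e' w).2.2 = c)
    (φ : bd ≃ₜ E) (hφ : ∀ w, p (φ w) = q w) (junk : M × S → E) {b : M} (hb : b ∈ e.baseSet)
    (θ : S) :
    (boundaryTrivialization e he φ hφ junk).coordChange
      (boundaryTrivialization e' he' φ hφ junk) b θ = (e.coordChange e' b (θ, c)).1 := by
  classical
  change (e' (φ.symm (@dite _ (b ∈ e.baseSet) (Classical.propDecidable _) _ _))).2.1 = _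
  rw [dif_pos hb, φ.symm_apply_apply]
  rfl

/-- Both charts see the same subspace `bd` as the slice at `c`. This provides the preservation of
ends that conical extension requires. -/
theorem coordChange_snd_of_slice {e e' : Trivialization (S × unitInterval) q}
    (he : ∀ w ∈ e.source, w ∈ bd ↔ (e w).2.2 = c) (he' : ∀ w ∈ e'.source, w ∈ bd ↔ (e' w).2.2 = c)
    {b : M} (hb : b ∈ e.baseSet) (hb' : b ∈ e'.baseSet) (θ : S) :
    (e.coordChange e' b (θ, c)).2 = c := by
  refine (he' _ (e'.mem_source.2 ?_)).1 ((he _ (e.map_target (e.mem_target.2 hb))).2 ?_)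
  · rwa [e.proj_symm_apply' hb]
  · rw [e.apply_symm_apply' hb]

end Boundary

/-! ### The cone bundle and the conclusion -/

/-- The `ℝⁿ × ℝ`-bundle obtained from an `Sⁿ⁻¹ × [0,1]`-bundle by extending its coordinate changes
conically. -/
def suspendCore {n : ℕ} {M W ι : Type*} [TopologicalSpace M] [TopologicalSpace W] {q : W → M}
    {bd₀ bd₁ : Set W} (e : ι → Trivialization (UnitSphere n × unitInterval) q)
    (h₀ : ∀ i, ∀ w ∈ (e i).source, w ∈ bd₀ ↔ (e i w).2.2 = 0)
    (h₁ : ∀ i, ∀ w ∈ (e i).source, w ∈ bd₁ ↔ (e i w).2.2 = 1)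
    (k : M → ι) (hk : ∀ b, b ∈ (e (k b)).baseSet) :
    FiberBundleCore ι M (EuclideanSpace ℝ (Fin n) × ℝ) where
  baseSet i := (e i).baseSet
  isOpen_baseSet i := (e i).open_baseSet
  indexAt := k
  mem_baseSet_at := hk
  coordChange i j b := suspend ((e i).coordChange (e j) b)
  coordChange_self i b hb := suspend_id ((e i).coordChange_same_apply hb)
  continuousOn_coordChange i j := by
    apply continuousOn_suspend
    refine continuous_snd.comp_continuousOn
      ((e j).continuousOn_toFun.comp ((e i).continuousOn_invFun.mono ?_) ?_)
    · rintro ⟨b, x⟩ hb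
      exact (e i).mem_target.2 hb.1.1
    · rintro ⟨b, x⟩ hb
      have := (e i).proj_symm_apply' (x := x) hb.1.1
      apply (e j).mem_source.2
      exact (congrArg (· ∈ (e j).baseSet) this).mpr hb.1.2
  coordChange_comp i j l b hb :=
    suspend_comp (coordChange_snd_of_slice (h₀ i) (h₀ j) hb.1.1 hb.1.2)
      (coordChange_snd_of_slice (h₁ i) (h₁ j) hb.1.1 hb.1.2)
      ((e i).coordChange_coordChange (e j) (e l) hb.1.1 hb.1.2)

/-- Passing between local trivializations goes through the preferred index at `b`; the cocycle
condition removes it. -/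
theorem FiberBundleCore.localTriv_coordChange {ι M F : Type*} [TopologicalSpace M]
    [TopologicalSpace F] (Z : FiberBundleCore ι M F) (i j : ι) {b : M} (hi : b ∈ Z.baseSet i)
    (hj : b ∈ Z.baseSet j) (v : F) :
    (Z.localTriv i).coordChange (Z.localTriv j) b v = Z.coordChange i j b v := by
  rw [Trivialization.coordChange, Z.localTriv_symm_apply, Z.localTriv_apply]
  exact Z.coordChange_comp _ _ _ _ ⟨⟨hi, Z.mem_baseSet_at b⟩, hj⟩ v

/-- The reflection of `ℝⁿ × ℝ` that exchanges the regions `s < 0` and `‖v‖ < s`. -/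
def shearHomeomorph (n : ℕ) :
    EuclideanSpace ℝ (Fin n) × ℝ ≃ₜ EuclideanSpace ℝ (Fin n) × ℝ where
  toFun x := (x.1, ‖x.1‖ - x.2)
  invFun x := (x.1, ‖x.1‖ - x.2)
  left_inv x := by simp
  right_inv x := by simp
  continuous_toFun := by fun_prop
  continuous_invFun := by fun_prop

theorem Bundle.Trivialization.transFiberHomeomorph_coordChange {F F' M X : Type*}
    [TopologicalSpace F] [TopologicalSpace F'] [TopologicalSpace M] [TopologicalSpace X]
    {p : X → M} (e e' : Trivialization F p) (h : F ≃ₜ F') (b : M) (v : F') :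
    (e.transFiberHomeomorph h).coordChange (e'.transFiberHomeomorph h) b v =
      h (e.coordChange e' b (h.symm v)) :=
  rfl

end

theorem proposition4p2 (n : ℕ) {M E₀ E₁ : Type*} [TopologicalSpace M] [T2Space M]
    [ParacompactSpace M] [TopologicalSpace E₀] [TopologicalSpace E₁]
    (p₀ : E₀ → M) (p₁ : E₁ → M)
    (h₀ : IsTopBundle (UnitSphere n) p₀) (h₁ : IsTopBundle (UnitSphere n) p₁)
    (hbord : FiberwiseBordant (UnitSphere n) p₀ p₁) :
    StablyIsomorphic (inducedProj h₀) (inducedProj h₁) := by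
  obtain ⟨W, _, q, bd₀, bd₁, hW, ⟨φ₀, hφ₀⟩, ⟨φ₁, hφ₁⟩⟩ := hbord
  choose e hk he using hW
  have he₀ := fun i w hw => (he i w hw).1
  have he₁ := fun i w hw => (he i w hw).2
  -- The induced bundle is indexed by all trivializations of `p₀`, so the restricted charts are
  -- among its indices. Values off the base set are irrelevant and are taken from a chart around the
  -- point.
  let e₀ := fun i => boundaryTrivialization (e i) (he₀ i) φ₀ hφ₀
    fun y => (h₀ y.1).choose.toOpenPartialHomeomorph.symm y
  let e₁ := fun i => boundaryTrivialization (e i) (he₁ i) φ₁ hφ₁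
    fun y => (h₁ y.1).choose.toOpenPartialHomeomorph.symm y
  let Z := suspendCore e he₀ he₁ id hk
  refine ⟨1, BundleIso.trans (p' := Z.proj) ?_ (BundleIso.symm ?_)⟩
  · refine bundleIso_prod_line_of_coordChange (fun i => (inducedCore h₀).localTriv (e₀ i))
      Z.localTriv (fun _ => rfl) (fun b => ⟨b, hk b⟩) fun i j b hi hj v s hs => ?_
    rw [Z.localTriv_coordChange i j hi hj, (inducedCore h₀).localTriv_coordChange _ _ hi hj]
    refine (suspend_of_neg (coordChange_snd_of_slice (he₀ i) (he₀ j) hi hj) v hs).trans ?_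
    congr 2
    exact funext fun θ =>
      (boundaryTrivialization_coordChange (he₀ i) (he₀ j) φ₀ hφ₀ _ hi θ).symm
  · refine bundleIso_prod_line_of_coordChange (fun i => (inducedCore h₁).localTriv (e₁ i))
      (fun i => (Z.localTriv i).transFiberHomeomorph (shearHomeomorph n))
      (fun _ => rfl) (fun b => ⟨b, hk b⟩) fun i j b hi hj v s hs => ?_
    rw [Trivialization.transFiberHomeomorph_coordChange, Z.localTriv_coordChange i j hi hj,
      (inducedCore h₁).localTriv_coordChange _ _ hi hj]
    -- The shear turns `s < 0` into the region beyond the other end, where the coordinate changes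
    -- come from `p₁`.
    have hs' : ‖v‖ < ‖v‖ - s := by linarith
    have key : Z.coordChange i j b ((shearHomeomorph n).symm (v, s)) =
        ((inducedCore h₁).coordChange (e₁ i) (e₁ j) b v, ‖v‖ - s) := by
      refine (suspend_of_norm_lt (coordChange_snd_of_slice (he₁ i) (he₁ j) hi hj) v hs').trans ?_
      congr 2
      exact funext fun θ =>
        (boundaryTrivialization_coordChange (he₁ i) (he₁ j) φ₁ hφ₁ _ hi θ).symm
    rw [key]
    refine Prod.ext rfl ?_
    -- The Alexander extension preserves norms, so the sheared coordinate `s` is preserved too.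
    change ‖alexander _ v‖ - (‖v‖ - s) = s
    rw [norm_alexander]
    ring
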